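/- **Corollary (Szpilrajneous groups: $BS\Rightarrow TBS$ and $BS\Leftrightarrow TIS$).** A group $G$ is *Szpilrajneous* if every $G$-invariant partial order on a set with a free $G$-action extends to a $G$-invariant total order on that set. Let $X$ be a combinatorial 2-complex whose 2-cells are attached along immersed cycles, with universal cover $\widetilde X$. For a 2-cell $r$ of $\widetilde X$ let $\partial_{\mathsf p} r$ be its boundary path and $\partial r$ the set of 1-cells which it traverses. For a preorder $\preceq$ write $a\prec b$ for $a\preceq b$ and $b\not\preceq a$. * ($BS$) A *bislim structure* on $X$ is a $\pi_1X$-invariant preorder $\preceq$ on the 1-cells of $\widetilde X$ together with 1-cells $r^+,r^-$ in $\partial r$ for each 2-cell $r$ of $\widetilde X$, such that $g(r^\pm)=(gr)^\pm$ for all $g\in\pi_1X$, $r^+$ is traversed exactly once by $\partial_{\mathsf p} r$, and for all 2-cells $r_1\ne r_2$ of $\widetilde X$: if $r_1^+\subset\partial r_2$ then $r_1^+\prec r_2^+$, and if $r_2^-\subset\partial r_1$ then $r_1^+\prec r_2^+$. * ($TBS$) The bislim structure is *totally ordered* if $\preceq$ restricts to a total order on the set $\{r^+\}$ of all distinguished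 1-cells $r^+$. * ($TIS$) A *totally ordered invariant staggering* of $X$ consists of $\pi_1X$-invariant total orders $\prec$ on the 2-cells of $\widetilde X$, $\prec^+$ on a $\pi_1X$-invariant set $\mathcal E^+$ of 1-cells of $\widetilde X$, and $\prec^-$ on a $\pi_1X$-invariant set $\mathcal E^-$ of 1-cells of $\widetilde X$, such that for each 2-cell $\alpha$ of $\widetilde X$ the boundary $\partial\alpha$ contains 1-cells of $\mathcal E^+$ and of $\mathcal E^-$, and, with $\max^+(\alpha)$ the $\prec^+$-highest 1-cell of $\mathcal E^+$ in $\partial\alpha$ and $\min^-(\alpha)$ the $\prec^-$-lowest 1-cell of $\mathcal E^-$ in $\partial\alpha$: $\max^+(\alpha)$ is traversed exactly once by $\partial_{\mathsf p}\alpha$; and if $\alpha\prec\beta$ then $\max^+(\alpha)\prec^+\max^+(\beta)$ and $\min^-(\alpha)\prec^-\min^-(\beta)$. Suppose that $G$ is Szpilrajneous, and let $X$ be the presentation 2-complex of a presentation $\langle S\mid R\rangle$ of $G$ (with $S$ and $R$ of any cardinality) whose relators are nonempty cyclically reduced words. If $X$ has a bislim structure, then $X$ has a totally ordered bislim structure.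 Moreover, $X$ has a bislim structure if and only if $X$ has a totally ordered invariant staggering. -/

import Mathlib

universe u

/-! ### Combinatorial 2-complexes -/

section Words

variable {V E : Type u} (src tgt : E → V)

/-- Initial vertex of a directed 1-cell; `(e, true)` is `e` traversed from `src e` to `tgt e`, and
`(e, false)` is `e` traversed backwards. -/
def dirStart (d : E × Bool) : V := if d.2 then src d.1 else tgt d.1

/-- Terminal vertex of a directed 1-cell. -/
def dirEnd (d : E × Bool) : V := if d.2 then tgt d.1 else src d.1

/-- The same 1-cell with the opposite direction. -/
def dirInv (d : E × Bool) : E × Bool := (d.1, !d.2)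

/-- `l` is an edge-path starting at the given vertex. -/
def IsEdgePath : V → List (E × Bool) → Prop
  | _, [] => True
  | v, d :: l => dirStart src tgt d = v ∧ IsEdgePath (dirEnd src tgt d) l

/-- The endpoint of the edge-path `l` starting at the given vertex. -/
def pathEnd : V → List (E × Bool) → V
  | v, [] => v
  | _, d :: l => pathEnd (dirEnd src tgt d) l

@[simp] theorem dirStart_dirInv (d : E × Bool) :
    dirStart src tgt (dirInv d) = dirEnd src tgt d := by
  rcases d with ⟨e, _ | _⟩ <;> rfl

@[simp] theorem dirEnd_dirInv (d : E × Bool) :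
    dirEnd src tgt (dirInv d) = dirStart src tgt d := by
  rcases d with ⟨e, _ | _⟩ <;> rfl

@[simp] theorem dirInv_dirInv (d : E × Bool) : dirInv (dirInv d) = d := by
  rcases d with ⟨e, _ | _⟩ <;> rfl

@[simp] theorem isEdgePath_append (v : V) (l m : List (E × Bool)) :
    IsEdgePath src tgt v (l ++ m) ↔
      IsEdgePath src tgt v l ∧ IsEdgePath src tgt (pathEnd src tgt v l) m := by
  induction l generalizing v with
  | nil => simp [IsEdgePath, pathEnd]
  | cons d l ih => simp [IsEdgePath, pathEnd, ih, and_assoc]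

@[simp] theorem pathEnd_append (v : V) (l m : List (E × Bool)) :
    pathEnd src tgt v (l ++ m) = pathEnd src tgt (pathEnd src tgt v l) m := by
  induction l generalizing v with
  | nil => rfl
  | cons d l ih => simpa [pathEnd] using ih _

/-- The reversed edge-path. -/
def pathRev (l : List (E × Bool)) : List (E × Bool) := (l.map dirInv).reverse

theorem isEdgePath_pathRev (v : V) (l : List (E × Bool)) (h : IsEdgePath src tgt v l) :
    IsEdgePath src tgt (pathEnd src tgt v l) (pathRev l) ∧
      pathEnd src tgt (pathEnd src tgt v l) (pathRev l) = v := by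
  induction l generalizing v with
  | nil => exact ⟨trivial, rfl⟩
  | cons d l ih =>
    obtain ⟨h1, h2⟩ := ih _ h.2
    have e : pathRev (d :: l) = pathRev l ++ [dirInv d] := by simp [pathRev]
    have h3 := h.1
    rw [e]
    simp only [isEdgePath_append, pathEnd_append]
    simp only [pathEnd, IsEdgePath, h1, h2, dirStart_dirInv, dirEnd_dirInv, h3, and_self]

end Words

/-- A combinatorial 2-complex: 0-cells, 1-cells (each with a chosen orientation), and 2-cells, each
attached along a closed edge-path `bdry f` which starts and ends at `base f`. -/
structure TwoComplex where
  Vert : Type u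
  Edge : Type u
  Face : Type u
  src : Edge → Vert
  tgt : Edge → Vert
  base : Face → Vert
  bdry : Face → List (Edge × Bool)
  bdry_isPath : ∀ f, IsEdgePath src tgt (base f) (bdry f)
  bdry_closed : ∀ f, pathEnd src tgt (base f) (bdry f) = base f

namespace TwoComplex

/-- All attaching maps are immersed cycles: the boundary paths are nonempty and have no
backtracking, also not between the last and the first directed 1-cell. -/
def Immersed (X : TwoComplex.{u}) : Prop :=
  ∀ f, X.bdry f ≠ [] ∧ FreeGroup.IsCyclicallyReduced (X.bdry f)

/-- The 1-cell `e` lies in `∂f`. -/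
def InBdry (X : TwoComplex.{u}) (e : X.Edge) (f : X.Face) : Prop :=
  e ∈ (X.bdry f).map Prod.fst

open Classical in
/-- The number of times that the boundary path of `f` traverses the 1-cell `e`, in either
direction. -/
noncomputable def traversals (X : TwoComplex.{u}) (e : X.Edge) (f : X.Face) : ℕ :=
  ((X.bdry f).map Prod.fst).count e

/-! ### Homotopy of edge-paths, the fundamental group, and the universal cover -/

variable (X : TwoComplex.{u}) (x₀ : X.Vert)

/-- Edge-paths of `X` which start at `x₀`. -/
def PathsFrom : Type u := {l : List (X.Edge × Bool) // IsEdgePath X.src X.tgt x₀ l}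

/-- Elementary homotopies: deleting a backtrack, or deleting the boundary path of a 2-cell. -/
inductive HomotopyStep : List (X.Edge × Bool) → List (X.Edge × Bool) → Prop
  | backtrack (p : List (X.Edge × Bool)) (d : X.Edge × Bool) (q : List (X.Edge × Bool)) :
      HomotopyStep (p ++ ([d, dirInv d] ++ q)) (p ++ q)
  | face (p : List (X.Edge × Bool)) (f : X.Face) (q : List (X.Edge × Bool)) :
      HomotopyStep (p ++ (X.bdry f ++ q)) (p ++ q)

/-- The 0-cells of the universal cover: edge-paths from `x₀` modulo the equivalence relation
generated by elementary homotopies between edge-paths. -/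
def CoverVert : Type u := Quot fun p q : X.PathsFrom x₀ => X.HomotopyStep p.1 q.1

variable {X x₀}

theorem HomotopyStep.pathEnd_eq {v : X.Vert} {l m : List (X.Edge × Bool)}
    (h : X.HomotopyStep l m) (hl : IsEdgePath X.src X.tgt v l) :
    pathEnd X.src X.tgt v l = pathEnd X.src X.tgt v m := by
  cases h with
  | backtrack p d q =>
    simp only [isEdgePath_append, IsEdgePath, pathEnd_append, pathEnd] at hl ⊢
    rw [dirEnd_dirInv, hl.2.1.1]
  | face p f q =>
    simp only [isEdgePath_append, pathEnd_append] at hl ⊢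
    by_cases hb : X.bdry f = []
    · simp [hb, pathEnd]
    · have key : pathEnd X.src X.tgt v p = X.base f := by
        have h1 := hl.2.1
        have h2 := X.bdry_isPath f
        revert h1 h2 hb
        cases X.bdry f with
        | nil => intro hb; exact absurd rfl hb
        | cons d l => intro _ h1 h2; exact h1.1.symm.trans h2.1
      rw [key, X.bdry_closed]

theorem HomotopyStep.append_left {l m : List (X.Edge × Bool)} (h : X.HomotopyStep l m)
    (k : List (X.Edge × Bool)) : X.HomotopyStep (k ++ l) (k ++ m) := by
  cases h with
  | backtrack p d q => simpa using HomotopyStep.backtrack (X := X) (k ++ p) d q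
  | face p f q => simpa using HomotopyStep.face (X := X) (k ++ p) f q

theorem HomotopyStep.append_right {l m : List (X.Edge × Bool)} (h : X.HomotopyStep l m)
    (k : List (X.Edge × Bool)) : X.HomotopyStep (l ++ k) (m ++ k) := by
  cases h with
  | backtrack p d q => simpa using HomotopyStep.backtrack (X := X) p d (q ++ k)
  | face p f q => simpa using HomotopyStep.face (X := X) p f (q ++ k)

/-- The endpoint in `X` of a homotopy class, i.e. the covering projection on 0-cells. -/
def CoverVert.proj (x : X.CoverVert x₀) : X.Vert :=
  Quot.lift (fun p : X.PathsFrom x₀ => pathEnd X.src X.tgt x₀ p.1)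
    (fun p _ h => h.pathEnd_eq p.2) x

/-- The class of a path. -/
def CoverVert.mk (l : List (X.Edge × Bool)) (h : IsEdgePath X.src X.tgt x₀ l) : X.CoverVert x₀ :=
  Quot.mk _ ⟨l, h⟩

theorem CoverVert.ind {P : X.CoverVert x₀ → Prop} (h : ∀ l hl, P (CoverVert.mk l hl))
    (x : X.CoverVert x₀) : P x :=
  Quot.ind (fun p => h p.1 p.2) x

theorem CoverVert.proj_mk (l : List (X.Edge × Bool)) (h : IsEdgePath X.src X.tgt x₀ l) :
    (CoverVert.mk l h).proj = pathEnd X.src X.tgt x₀ l := rfl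

theorem CoverVert.mk_eq_mk {l m : List (X.Edge × Bool)} (s : X.HomotopyStep l m)
    (hl : IsEdgePath X.src X.tgt x₀ l) (hm : IsEdgePath X.src X.tgt x₀ m) :
    CoverVert.mk l hl = CoverVert.mk m hm :=
  Quot.sound s

theorem CoverVert.mk_congr {l m : List (X.Edge × Bool)} (e : l = m)
    (hl : IsEdgePath X.src X.tgt x₀ l) (hm : IsEdgePath X.src X.tgt x₀ m) :
    CoverVert.mk l hl = CoverVert.mk m hm := by
  subst e; rfl

/-- Concatenation of the class `x` with an edge-path `l` that starts at its endpoint. -/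
def CoverVert.extend (x : X.CoverVert x₀) (l : List (X.Edge × Bool))
    (h : IsEdgePath X.src X.tgt x.proj l) : X.CoverVert x₀ :=
  Quot.hrecOn (motive := fun x : X.CoverVert x₀ =>
      IsEdgePath X.src X.tgt (CoverVert.proj x) l → X.CoverVert x₀) x
    (fun p hp => CoverVert.mk (p.1 ++ l) ((isEdgePath_append _ _ _ _ _).2 ⟨p.2, hp⟩))
    (fun p q s => by
      have e : CoverVert.proj (Quot.mk _ p : X.CoverVert x₀) =
          CoverVert.proj (Quot.mk _ q : X.CoverVert x₀) := s.pathEnd_eq p.2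
      refine Function.hfunext (by rw [e]) ?_
      intro hp hq _
      exact heq_of_eq (CoverVert.mk_eq_mk (s.append_right l) _ _)) h

theorem CoverVert.extend_mk (k l : List (X.Edge × Bool)) (hk : IsEdgePath X.src X.tgt x₀ k)
    (h : IsEdgePath X.src X.tgt (CoverVert.mk k hk).proj l) :
    (CoverVert.mk k hk).extend l h =
      CoverVert.mk (k ++ l) ((isEdgePath_append _ _ _ _ _).2 ⟨hk, h⟩) := rfl

theorem CoverVert.proj_extend (x : X.CoverVert x₀) (l : List (X.Edge × Bool))
    (h : IsEdgePath X.src X.tgt x.proj l) :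
    (x.extend l h).proj = pathEnd X.src X.tgt x.proj l := by
  induction x using CoverVert.ind with
  | h k hk => exact pathEnd_append _ _ _ _ _

theorem CoverVert.extend_extend (x : X.CoverVert x₀) (l m : List (X.Edge × Bool))
    (h : IsEdgePath X.src X.tgt x.proj l) (h' : IsEdgePath X.src X.tgt (x.extend l h).proj m) :
    (x.extend l h).extend m h' =
      x.extend (l ++ m) ((isEdgePath_append _ _ _ _ _).2 ⟨h, by rwa [← proj_extend x l h]⟩) := by
  induction x using CoverVert.ind with
  | h k hk => exact CoverVert.mk_congr (List.append_assoc _ _ _) _ _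

theorem CoverVert.extend_nil (x : X.CoverVert x₀) : x.extend [] trivial = x := by
  induction x using CoverVert.ind with
  | h k hk => exact CoverVert.mk_congr (List.append_nil _) _ _

theorem CoverVert.extend_bdry (x : X.CoverVert x₀) (f : X.Face) (hf : x.proj = X.base f) :
    x.extend (X.bdry f) (hf ▸ X.bdry_isPath f) = x := by
  induction x using CoverVert.ind with
  | h k hk => exact CoverVert.mk_eq_mk (by simpa using HomotopyStep.face (X := X) k f []) _ _

theorem CoverVert.extend_backtrack (x : X.CoverVert x₀) (d : X.Edge × Bool)
    (hd : IsEdgePath X.src X.tgt x.proj [d, dirInv d]) :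
    x.extend [d, dirInv d] hd = x := by
  induction x using CoverVert.ind with
  | h k hk => exact CoverVert.mk_eq_mk (by simpa using HomotopyStep.backtrack (X := X) k d []) _ _

variable (X x₀)

/-- The 1-cells of the universal cover: a lift of the 1-cell `e` is determined by the lift of its
initial vertex. -/
def CoverEdge : Type u := {x : X.CoverVert x₀ × X.Edge // x.1.proj = X.src x.2}

/-- The 2-cells of the universal cover: a lift of the 2-cell `f` is determined by the lift of its
base vertex. -/
def CoverFace : Type u := {x : X.CoverVert x₀ × X.Face // x.1.proj = X.base x.2}

variable {X x₀}

/-- The initial vertex of a lifted 1-cell. -/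
def CoverEdge.src (e : X.CoverEdge x₀) : X.CoverVert x₀ := e.1.1

/-- The terminal vertex of a lifted 1-cell. -/
def CoverEdge.tgt (e : X.CoverEdge x₀) : X.CoverVert x₀ :=
  e.1.1.extend [(e.1.2, true)] ⟨e.2.symm, trivial⟩

/-- The lifted 1-cell that is traversed by the lift starting at `x` of the directed 1-cell `d`. -/
def CoverVert.edgeAt (x : X.CoverVert x₀) : (d : X.Edge × Bool) →
    dirStart X.src X.tgt d = x.proj → X.CoverEdge x₀
  | (e, true), h => ⟨(x, e), h.symm⟩
  | (e, false), h => ⟨(x.extend [(e, false)] ⟨h, trivial⟩, e), CoverVert.proj_extend _ _ _⟩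

theorem CoverVert.isEdgePath_extend (x : X.CoverVert x₀) (d : X.Edge × Bool)
    (l : List (X.Edge × Bool)) (h : IsEdgePath X.src X.tgt x.proj (d :: l)) :
    IsEdgePath X.src X.tgt (x.extend [d] ⟨h.1, trivial⟩).proj l :=
  (CoverVert.proj_extend x [d] ⟨h.1, trivial⟩).symm ▸ h.2

/-- The lift starting at `x` of an edge-path of `X`. -/
def CoverVert.lift : (x : X.CoverVert x₀) → (l : List (X.Edge × Bool)) →
    IsEdgePath X.src X.tgt x.proj l → List (X.CoverEdge x₀ × Bool)
  | _, [], _ => []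
  | x, d :: l, h => (x.edgeAt d h.1, d.2) ::
      (x.extend [d] ⟨h.1, trivial⟩).lift l (CoverVert.isEdgePath_extend x d l h)

theorem CoverVert.dirStart_edgeAt (x : X.CoverVert x₀) (d : X.Edge × Bool)
    (h : dirStart X.src X.tgt d = x.proj) :
    dirStart CoverEdge.src CoverEdge.tgt (x.edgeAt d h, d.2) = x := by
  rcases d with ⟨e, _ | _⟩
  · exact (CoverVert.extend_extend x [(e, false)] [(e, true)] _ _).trans
      (CoverVert.extend_backtrack x (e, false) ⟨h, rfl, trivial⟩)
  · rfl

theorem CoverVert.dirEnd_edgeAt (x : X.CoverVert x₀) (d : X.Edge × Bool)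
    (h : dirStart X.src X.tgt d = x.proj) :
    dirEnd CoverEdge.src CoverEdge.tgt (x.edgeAt d h, d.2) = x.extend [d] ⟨h, trivial⟩ := by
  rcases d with ⟨e, _ | _⟩ <;> rfl

theorem CoverVert.lift_spec (x : X.CoverVert x₀) (l : List (X.Edge × Bool))
    (h : IsEdgePath X.src X.tgt x.proj l) :
    IsEdgePath CoverEdge.src CoverEdge.tgt x (x.lift l h) ∧
      pathEnd CoverEdge.src CoverEdge.tgt x (x.lift l h) = x.extend l h := by
  induction l generalizing x with
  | nil => exact ⟨trivial, (CoverVert.extend_nil x).symm⟩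
  | cons d l ih =>
    obtain ⟨h1, h2⟩ := ih (x.extend [d] ⟨h.1, trivial⟩)
      (CoverVert.isEdgePath_extend x d l h)
    simp only [CoverVert.lift, IsEdgePath, pathEnd, CoverVert.dirEnd_edgeAt]
    refine ⟨⟨CoverVert.dirStart_edgeAt _ _ _, h1⟩, h2.trans ?_⟩
    exact CoverVert.extend_extend _ _ _ _ _

variable (X x₀)

/-- The universal cover of (the component of `x₀` in) `X`. -/
def cover : TwoComplex.{u} where
  Vert := X.CoverVert x₀
  Edge := X.CoverEdge x₀
  Face := X.CoverFace x₀
  src := CoverEdge.src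
  tgt := CoverEdge.tgt
  base f := f.1.1
  bdry f := f.1.1.lift (X.bdry f.1.2) (f.2 ▸ X.bdry_isPath f.1.2)
  bdry_isPath f := (CoverVert.lift_spec _ _ _).1
  bdry_closed f := (CoverVert.lift_spec _ _ _).2.trans (CoverVert.extend_bdry _ _ f.2)

/-- The fundamental group: homotopy classes of closed edge-paths at `x₀`. -/
def FundGroup : Type u := {x : X.CoverVert x₀ // x.proj = x₀}

variable {X x₀}

theorem FundGroup.isEdgePath_append {k l : List (X.Edge × Bool)}
    (hk : IsEdgePath X.src X.tgt x₀ k) (hc : (CoverVert.mk k hk).proj = x₀)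
    (hl : IsEdgePath X.src X.tgt x₀ l) : IsEdgePath X.src X.tgt x₀ (k ++ l) :=
  (_root_.isEdgePath_append _ _ _ _ _).2 ⟨hk, by
    rw [show pathEnd X.src X.tgt x₀ k = x₀ from hc]; exact hl⟩

/-- The action of the fundamental group on the 0-cells of the universal cover:
concatenation on the left. -/
def FundGroup.act (g : X.FundGroup x₀) (x : X.CoverVert x₀) : X.CoverVert x₀ :=
  Quot.lift (fun p : X.PathsFrom x₀ => g.1.extend p.1 (by rw [g.2]; exact p.2))
    (fun p q s => by
      obtain ⟨g, hg⟩ := g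
      revert hg
      induction g using CoverVert.ind with
      | h k hk => intro hg; exact CoverVert.mk_eq_mk (s.append_left k) _ _) x

theorem FundGroup.act_mk {k l : List (X.Edge × Bool)}
    (hk : IsEdgePath X.src X.tgt x₀ k) (hc : (CoverVert.mk k hk).proj = x₀)
    (hl : IsEdgePath X.src X.tgt x₀ l) :
    FundGroup.act ⟨CoverVert.mk k hk, hc⟩ (CoverVert.mk l hl) =
      CoverVert.mk (k ++ l) (FundGroup.isEdgePath_append hk hc hl) := rfl

theorem FundGroup.proj_act (g : X.FundGroup x₀) (x : X.CoverVert x₀) :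
    (g.act x).proj = x.proj := by
  induction x using CoverVert.ind with
  | h l hl =>
    refine (CoverVert.proj_extend g.1 l (by rw [g.2]; exact hl)).trans ?_
    rw [g.2]; rfl

theorem FundGroup.act_extend (g : X.FundGroup x₀) (x : X.CoverVert x₀)
    (l : List (X.Edge × Bool)) (h : IsEdgePath X.src X.tgt x.proj l) :
    g.act (x.extend l h) = (g.act x).extend l (by rw [g.proj_act]; exact h) := by
  induction x using CoverVert.ind with
  | h k hk =>
    obtain ⟨g, hg⟩ := g
    revert hg
    induction g using CoverVert.ind with
    | h j hj =>
      intro hg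
      exact CoverVert.mk_congr (List.append_assoc _ _ _).symm _ _

/-- Homotopy class of the constant path. -/
def FundGroup.one : X.FundGroup x₀ := ⟨CoverVert.mk [] trivial, rfl⟩

/-- Product of homotopy classes of closed paths: concatenation. -/
def FundGroup.mul (g h : X.FundGroup x₀) : X.FundGroup x₀ :=
  ⟨g.act h.1, (g.proj_act h.1).trans h.2⟩

theorem CoverVert.extend_congr (x : X.CoverVert x₀) {l m : List (X.Edge × Bool)} (e : l = m)
    (hl : IsEdgePath X.src X.tgt x.proj l) (hm : IsEdgePath X.src X.tgt x.proj m) :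
    x.extend l hl = x.extend m hm := by
  subst e; rfl

theorem CoverVert.extend_pathRev (x : X.CoverVert x₀) (l : List (X.Edge × Bool))
    (h : IsEdgePath X.src X.tgt x.proj (l ++ pathRev l)) : x.extend (l ++ pathRev l) h = x := by
  induction l generalizing x with
  | nil => exact CoverVert.extend_nil x
  | cons d l ih =>
    have e : (d :: l) ++ pathRev (d :: l) = [d] ++ ((l ++ pathRev l) ++ [dirInv d]) := by
      simp [pathRev]
    have h' : IsEdgePath X.src X.tgt x.proj ([d] ++ ((l ++ pathRev l) ++ [dirInv d])) := e ▸ h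
    obtain ⟨h1, h2⟩ := (isEdgePath_append _ _ _ _ _).1 h'
    have h2' := h2
    rw [show pathEnd X.src X.tgt x.proj [d] = (x.extend [d] h1).proj from
      (CoverVert.proj_extend x [d] h1).symm] at h2
    have h3 := ((isEdgePath_append _ _ _ _ _).1 h2).1
    have h4 : IsEdgePath X.src X.tgt (x.extend [d] h1).proj [dirInv d] := by
      rw [CoverVert.proj_extend]
      exact ⟨dirStart_dirInv _ _ _, trivial⟩
    rw [CoverVert.extend_congr x e h h', ← CoverVert.extend_extend x [d] _ h1 h2]
    have h5 : IsEdgePath X.src X.tgt ((x.extend [d] h1).extend _ h3).proj [dirInv d] := by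
      rw [ih _ h3]; exact h4
    rw [← CoverVert.extend_extend _ _ _ h3 h5]
    have key : ∀ (y z : X.CoverVert x₀) (_ : y = z)
        (hy : IsEdgePath X.src X.tgt y.proj [dirInv d])
        (hz : IsEdgePath X.src X.tgt z.proj [dirInv d]),
        y.extend [dirInv d] hy = z.extend [dirInv d] hz := by
      intro y z hyz _ _; subst hyz; rfl
    rw [key _ _ (ih _ h3) h5 h4, CoverVert.extend_extend]
    exact CoverVert.extend_backtrack x d _

theorem FundGroup.ind {P : X.FundGroup x₀ → Prop}
    (h : ∀ l hl hc, P ⟨CoverVert.mk l hl, hc⟩) (g : X.FundGroup x₀) : P g := by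
  obtain ⟨g, hg⟩ := g
  revert hg
  induction g using CoverVert.ind with
  | h l hl => exact fun hg => h l hl hg

theorem FundGroup.one_act (x : X.CoverVert x₀) : FundGroup.one.act x = x := by
  induction x using CoverVert.ind with
  | h l hl => rfl

theorem FundGroup.mul_act (g h : X.FundGroup x₀) (x : X.CoverVert x₀) :
    (g.mul h).act x = g.act (h.act x) := by
  induction x using CoverVert.ind with
  | h l hl =>
    induction g using FundGroup.ind with
    | h j hj hjc =>
      induction h using FundGroup.ind with
      | h k hk hkc => exact CoverVert.mk_congr (List.append_assoc _ _ _) _ _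

instance instMonoidFundGroup : Monoid (X.FundGroup x₀) where
  mul := FundGroup.mul
  one := FundGroup.one
  mul_assoc g h k := Subtype.ext (FundGroup.mul_act g h k.1)
  one_mul g := Subtype.ext (FundGroup.one_act g.1)
  mul_one g := by
    induction g using FundGroup.ind with
    | h l hl hc => exact Subtype.ext (CoverVert.mk_congr (List.append_nil l) _ _)

theorem FundGroup.exists_mul_eq_one (g : X.FundGroup x₀) : ∃ h : X.FundGroup x₀, g * h = 1 := by
  induction g using FundGroup.ind with
  | h l hl hc =>
    have hc' : pathEnd X.src X.tgt x₀ l = x₀ := hc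
    obtain ⟨h1, h2⟩ := isEdgePath_pathRev X.src X.tgt x₀ l hl
    rw [hc'] at h1 h2
    refine ⟨⟨CoverVert.mk (pathRev l) h1, h2⟩, Subtype.ext ?_⟩
    exact CoverVert.extend_pathRev (CoverVert.mk [] trivial) l
      (FundGroup.isEdgePath_append hl hc h1)

noncomputable instance instGroupFundGroup : Group (X.FundGroup x₀) :=
  groupOfIsUnit fun g => by
    obtain ⟨h, hgh⟩ := FundGroup.exists_mul_eq_one g
    obtain ⟨k, hhk⟩ := FundGroup.exists_mul_eq_one h
    have e : g = k := by rw [← mul_one g, ← hhk, ← mul_assoc, hgh, one_mul]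
    exact ⟨⟨g, h, hgh, e ▸ hhk⟩, rfl⟩

/-- The action of the fundamental group on the 1-cells of the universal cover. -/
instance instMulActionCoverEdge : MulAction (X.FundGroup x₀) (X.cover x₀).Edge where
  smul g e := (⟨(g.act e.1.1, e.1.2), (g.proj_act _).trans e.2⟩ : X.CoverEdge x₀)
  one_smul e := Subtype.ext (Prod.ext (FundGroup.one_act _) rfl)
  mul_smul g h e := Subtype.ext (Prod.ext (FundGroup.mul_act g h _) rfl)

/-- The action of the fundamental group on the 2-cells of the universal cover. -/
instance instMulActionCoverFace : MulAction (X.FundGroup x₀) (X.cover x₀).Face where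
  smul g f := (⟨(g.act f.1.1, f.1.2), (g.proj_act _).trans f.2⟩ : X.CoverFace x₀)
  one_smul f := Subtype.ext (Prod.ext (FundGroup.one_act _) rfl)
  mul_smul g h f := Subtype.ext (Prod.ext (FundGroup.mul_act g h _) rfl)

/-! ### Bislim structures and totally ordered invariant staggerings -/

variable (X x₀)

/-- A bislim structure on `X`: a `π₁`-invariant preorder on the 1-cells of the universal cover,
and `π₁`-equivariantly distinguished 1-cells `r⁺ = top r` and `r⁻ = bot r` in `∂r` for each 2-cell
`r` of the universal cover. -/
structure BislimStructure where
  le : (X.cover x₀).Edge → (X.cover x₀).Edge → Prop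
  le_refl : ∀ a, le a a
  le_trans : ∀ a b c, le a b → le b c → le a c
  le_smul : ∀ (g : X.FundGroup x₀) a b, le a b → le (g • a) (g • b)
  top : (X.cover x₀).Face → (X.cover x₀).Edge
  bot : (X.cover x₀).Face → (X.cover x₀).Edge
  top_mem : ∀ r, (X.cover x₀).InBdry (top r) r
  bot_mem : ∀ r, (X.cover x₀).InBdry (bot r) r
  top_once : ∀ r, (X.cover x₀).traversals (top r) r = 1
  top_smul : ∀ (g : X.FundGroup x₀) r, top (g • r) = g • top r
  bot_smul : ∀ (g : X.FundGroup x₀) r, bot (g • r) = g • bot r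
  top_lt_of_top_mem : ∀ r₁ r₂, r₁ ≠ r₂ → (X.cover x₀).InBdry (top r₁) r₂ →
    le (top r₁) (top r₂) ∧ ¬ le (top r₂) (top r₁)
  top_lt_of_bot_mem : ∀ r₁ r₂, r₁ ≠ r₂ → (X.cover x₀).InBdry (bot r₂) r₁ →
    le (top r₁) (top r₂) ∧ ¬ le (top r₂) (top r₁)

variable {X x₀} in
/-- A bislim structure is totally ordered if its preorder restricts to a total order on the set of
all 1-cells `r⁺`. -/
def BislimStructure.IsTotallyOrdered (B : X.BislimStructure x₀) : Prop :=
  IsLinearOrder (Set.range B.top) fun a b => B.le a b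

/-- `BS`: `X` has a bislim structure. -/
def IsBislim : Prop := Nonempty (X.BislimStructure x₀)

/-- `TBS`: `X` has a totally ordered bislim structure. -/
def IsTotallyOrderedBislim : Prop := ∃ B : X.BislimStructure x₀, B.IsTotallyOrdered

/-- `e` is the highest 1-cell of `∂f` among those in `S`, for the relation `lt`. The lowest 1-cell
is the highest one for the swapped relation. -/
def IsHighest (Y : TwoComplex.{u}) (S : Set Y.Edge) (lt : Y.Edge → Y.Edge → Prop) (f : Y.Face)
    (e : Y.Edge) : Prop :=
  (e ∈ S ∧ Y.InBdry e f) ∧ ∀ e' ∈ S, Y.InBdry e' f → e' ≠ e → lt e' e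

/-- A totally ordered invariant staggering of `X`: `π₁`-invariant total orders on the 2-cells of
the universal cover and on two `π₁`-invariant sets `plus` and `minus` of its 1-cells (`ltPlus` and
`ltMinus` only matter on `plus` and `minus`). -/
structure InvariantStaggering where
  lt : (X.cover x₀).Face → (X.cover x₀).Face → Prop
  lt_total : IsStrictTotalOrder (X.cover x₀).Face lt
  lt_smul : ∀ (g : X.FundGroup x₀) a b, lt a b → lt (g • a) (g • b)
  plus : Set (X.cover x₀).Edge
  plus_smul : ∀ (g : X.FundGroup x₀), ∀ e ∈ plus, g • e ∈ plus
  ltPlus : (X.cover x₀).Edge → (X.cover x₀).Edge → Prop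
  ltPlus_total : IsStrictTotalOrder plus fun a b => ltPlus a b
  ltPlus_smul : ∀ (g : X.FundGroup x₀), ∀ a ∈ plus, ∀ b ∈ plus,
    ltPlus a b → ltPlus (g • a) (g • b)
  minus : Set (X.cover x₀).Edge
  minus_smul : ∀ (g : X.FundGroup x₀), ∀ e ∈ minus, g • e ∈ minus
  ltMinus : (X.cover x₀).Edge → (X.cover x₀).Edge → Prop
  ltMinus_total : IsStrictTotalOrder minus fun a b => ltMinus a b
  ltMinus_smul : ∀ (g : X.FundGroup x₀), ∀ a ∈ minus, ∀ b ∈ minus,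
    ltMinus a b → ltMinus (g • a) (g • b)
  exists_plus : ∀ f, ∃ e ∈ plus, (X.cover x₀).InBdry e f
  exists_minus : ∀ f, ∃ e ∈ minus, (X.cover x₀).InBdry e f
  max_once : ∀ f e, (X.cover x₀).IsHighest plus ltPlus f e → (X.cover x₀).traversals e f = 1
  max_lt_max : ∀ f f', lt f f' → ∀ e e', (X.cover x₀).IsHighest plus ltPlus f e →
    (X.cover x₀).IsHighest plus ltPlus f' e' → ltPlus e e'
  min_lt_min : ∀ f f', lt f f' → ∀ e e',
    (X.cover x₀).IsHighest minus (fun a b => ltMinus b a) f e →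
    (X.cover x₀).IsHighest minus (fun a b => ltMinus b a) f' e' → ltMinus e e'

/-- `TIS`: `X` has a totally ordered invariant staggering. -/
def HasTIS : Prop := Nonempty (X.InvariantStaggering x₀)

end TwoComplex

/-! ### Presentations and Szpilrajneous groups -/

section Presentation

variable {S R : Type u} (rel : R → List (S × Bool))

/-- The group with generators `S` and relators the words `rel r`, where `(s, true)` stands for `s`
and `(s, false)` for `s⁻¹`. -/
abbrev GroupOfPresentation : Type u :=
  PresentedGroup (Set.range fun r => FreeGroup.mk (rel r))

theorem isEdgePath_unit (l : List (S × Bool)) (v : PUnit.{u + 1}) :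
    IsEdgePath (fun _ : S => PUnit.unit) (fun _ => PUnit.unit) v l := by
  induction l generalizing v with
  | nil => trivial
  | cons d l ih => exact ⟨rfl, ih _⟩

/-- The presentation 2-complex: one 0-cell, a 1-cell for each generator, and a 2-cell attached
along `rel r` for each `r`. -/
def presentationComplex : TwoComplex.{u} where
  Vert := PUnit
  Edge := S
  Face := R
  src _ := PUnit.unit
  tgt _ := PUnit.unit
  base _ := PUnit.unit
  bdry := rel
  bdry_isPath _ := isEdgePath_unit _ _
  bdry_closed _ := rfl

/-- The unique 0-cell of the presentation 2-complex, as base point. -/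
def presentationVertex : (presentationComplex rel).Vert := PUnit.unit

end Presentation

/-- `G` is Szpilrajneous: every `G`-invariant partial order on a set with a free `G`-action extends
to a `G`-invariant total order. -/
def Szpilrajneous (G : Type u) [Group G] : Prop :=
  ∀ (Ω : Type u) [MulAction G Ω], (∀ (g : G) (x : Ω), g • x = x → g = 1) →
    ∀ le : Ω → Ω → Prop, IsPartialOrder Ω le → (∀ (g : G) a b, le a b → le (g • a) (g • b)) →
      ∃ le' : Ω → Ω → Prop, IsLinearOrder Ω le' ∧
        (∀ (g : G) a b, le' a b → le' (g • a) (g • b)) ∧ ∀ a b, le a b → le' a b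

/-! ### The Szpilrajn property -/

section SzpilrajnProperty

/-! The fundamental group of a presentation complex is the presented group
(`fundGroupHom_bijective`), and it acts freely on the 1-cells of the universal cover
(`edge_action_free`), so the Szpilrajn property applies to orders on these 1-cells.

BS to TBS: the bislim conditions demand only strict inequalities. Ties in the preorder can therefore
be dropped, which leaves an invariant partial order. An invariant total extension of it keeps every
strict inequality and serves the same `r⁺` and `r⁻` (`BislimStructure.exists_isLinearOrder`).

TBS to TIS: `r ↦ r⁺` and `r ↦ r⁻` are injective, so the order of the `r⁺` can be carried to the
2-cells and from there to the set of all `r⁻`. The two bislim conditions then say that `r⁺` is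
highest and `r⁻` is lowest in `∂r` (`isHighest_top`, `isLowest_bot`).

TIS to BS: `r⁺` is the highest and `r⁻` the lowest 1-cell of `∂r`, and the preorder is `≺⁺` together
with equality (`InvariantStaggering.isBislim`). -/

theorem Szpilrajneous.of_mulEquiv {G H : Type u} [Group G] [Group H] (hG : Szpilrajneous G)
    (e : H ≃* G) : Szpilrajneous H := by
  intro Ω _ hfree le hle hinv
  let _ : MulAction G Ω := MulAction.compHom Ω e.symm.toMonoidHom
  obtain ⟨le', h1, h2, h3⟩ := hG Ω
    (fun g x h => by simpa using hfree (e.symm g) x h) le hle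
    (fun g a b h => hinv (e.symm g) a b h)
  refine ⟨le', h1, fun g a b h => ?_, h3⟩
  have h4 : le' (e.symm (e g) • a) (e.symm (e g) • b) := h2 (e g) a b h
  simpa using h4

end SzpilrajnProperty

/-! ### The fundamental group of a presentation complex -/

section FundamentalGroup

open TwoComplex

variable {S R : Type u} (rel : R → List (S × Bool))

/-- The homotopy class of a word in the generators. -/
def wordClass (l : List (S × Bool)) :
    (presentationComplex rel).FundGroup (presentationVertex rel) :=
  ⟨CoverVert.mk l (isEdgePath_unit l _), rfl⟩

theorem wordClass_append (k l : List (S × Bool)) :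
    wordClass rel (k ++ l) = wordClass rel k * wordClass rel l := rfl

theorem wordClass_eq_of_step {k l : List (S × Bool)}
    (h : (presentationComplex rel).HomotopyStep k l) : wordClass rel k = wordClass rel l :=
  Subtype.ext (CoverVert.mk_eq_mk h _ _)

theorem wordClass_false (s : S) : wordClass rel [(s, false)] = (wordClass rel [(s, true)])⁻¹ := by
  refine eq_inv_of_mul_eq_one_left ?_
  exact wordClass_eq_of_step rel
    (HomotopyStep.backtrack (X := presentationComplex rel) [] (s, false) [])

theorem wordClass_rel (r : R) : wordClass rel (rel r) = 1 := by
  have h := wordClass_eq_of_step rel (HomotopyStep.face (X := presentationComplex rel) [] r [])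
  rwa [List.append_nil] at h

/-- Serves twice in `fundGroupHom_bijective`: relators die in the fundamental group, and the induced
map out of the presented group is a left inverse. -/
theorem lift_wordClass_mk (l : List (S × Bool)) :
    FreeGroup.lift (fun s => wordClass rel [(s, true)]) (FreeGroup.mk l) = wordClass rel l := by
  rw [FreeGroup.lift_mk]
  induction l with
  | nil => rfl
  | cons d l ih =>
    rw [List.map_cons, List.prod_cons, ih]
    change _ = wordClass rel ([d] ++ l)
    rw [wordClass_append]
    rcases d with ⟨s, _ | _⟩
    · rw [wordClass_false]; rfl
    · rfl

/-- The element of the presented group which is represented by a word. -/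
def wordValue (l : List (S × Bool)) : GroupOfPresentation rel :=
  PresentedGroup.mk _ (FreeGroup.mk l)

theorem wordValue_append (k l : List (S × Bool)) :
    wordValue rel (k ++ l) = wordValue rel k * wordValue rel l := by
  rw [wordValue, ← FreeGroup.mul_mk, map_mul]; rfl

/-- A backtrack is a free cancellation, and a deleted face boundary is a deleted relator. -/
theorem wordValue_eq_of_step {k l : List ((presentationComplex rel).Edge × Bool)}
    (h : (presentationComplex rel).HomotopyStep k l) : wordValue rel k = wordValue rel l := by
  cases h with
  | backtrack p d q =>
    refine congrArg (PresentedGroup.mk _) (Quot.sound ?_)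
    exact FreeGroup.Red.Step.not (L₁ := p) (L₂ := q) (x := d.1) (b := d.2)
  | face p f q =>
    have h1 : wordValue rel (rel f) = 1 :=
      PresentedGroup.one_of_mem (Set.mem_range_self f)
    have h2 : ∀ p q : List (S × Bool),
        wordValue rel (p ++ (rel f ++ q)) = wordValue rel (p ++ q) := fun p q => by
      simp only [wordValue_append, h1, one_mul]
    exact h2 p q

/-- The homomorphism from the fundamental group of the presentation complex to the presented
group. -/
def fundGroupHom :
    (presentationComplex rel).FundGroup (presentationVertex rel) →* GroupOfPresentation rel where
  toFun g := Quot.lift (fun p : (presentationComplex rel).PathsFrom (presentationVertex rel) =>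
    wordValue rel p.1) (fun _ _ h => wordValue_eq_of_step rel h) g.1
  map_one' := rfl
  map_mul' g h := by
    induction g using FundGroup.ind with
    | h k hk hkc =>
      induction h using FundGroup.ind with
      | h l hl hlc => exact wordValue_append rel k l

/-- Injectivity comes from the left inverse given by the universal property of the presented group;
surjectivity holds because, with a single vertex, every word is a closed path. -/
theorem fundGroupHom_bijective : Function.Bijective (fundGroupHom rel) := by
  constructor
  · have hrel : ∀ w ∈ Set.range fun r => FreeGroup.mk (rel r),
        FreeGroup.lift (fun s => wordClass rel [(s, true)]) w = 1 := by
      rintro _ ⟨r, rfl⟩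
      exact (lift_wordClass_mk rel _).trans (wordClass_rel rel r)
    refine Function.LeftInverse.injective (g := PresentedGroup.toGroup hrel) fun g => ?_
    induction g using FundGroup.ind with
    | h l hl hlc => exact lift_wordClass_mk rel l
  · intro x
    obtain ⟨w, rfl⟩ := PresentedGroup.mk_surjective _ x
    obtain ⟨l, rfl⟩ := Quot.exists_rep w
    exact ⟨wordClass rel l, rfl⟩

end FundamentalGroup

namespace TwoComplex

/-! ### The action on the universal cover -/

variable {X : TwoComplex.{u}} {x₀ : X.Vert}

/-- The group acts by concatenation on the left, so `g·x = x` can be cancelled on the right by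
appending the reverse of a path representing `x`. -/
theorem FundGroup.eq_one_of_act_eq (g : X.FundGroup x₀) (x : X.CoverVert x₀)
    (h : g.act x = x) : g = 1 := by
  induction x using CoverVert.ind with
  | h l hl =>
    have hl' := (isEdgePath_pathRev X.src X.tgt x₀ l hl).1
    have key : ∀ (y z : X.CoverVert x₀) (_ : y = z) (m : List (X.Edge × Bool))
        (hy : IsEdgePath X.src X.tgt y.proj m) (hz : IsEdgePath X.src X.tgt z.proj m),
        y.extend m hy = z.extend m hz := by
      intro y z hyz m _ _; subst hyz; rfl
    have hp : IsEdgePath X.src X.tgt (CoverVert.mk l hl).proj (pathRev l) := hl'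
    have e1 : (CoverVert.mk l hl).extend (pathRev l) hp = FundGroup.one.1 :=
      CoverVert.extend_pathRev (CoverVert.mk [] trivial) l
        ((_root_.isEdgePath_append _ _ _ _ _).2 ⟨hl, hl'⟩)
    have e2 := g.act_extend (CoverVert.mk l hl) (pathRev l) hp
    rw [key _ _ h _ _ hp, e1] at e2
    exact Subtype.ext ((congrArg Subtype.val (mul_one g)).symm.trans e2)

/-- A 1-cell is recorded by its initial vertex and the action respects orientations, so no 1-cell is
inverted and freeness on vertices suffices. -/
theorem edge_action_free (g : X.FundGroup x₀) (a : (X.cover x₀).Edge) (h : g • a = a) : g = 1 :=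
  g.eq_one_of_act_eq a.1.1 (congrArg (fun b : X.CoverEdge x₀ => b.1.1) h)

theorem FundGroup.smul_edgeAt (g : X.FundGroup x₀) (x : X.CoverVert x₀) (d : X.Edge × Bool)
    (h : dirStart X.src X.tgt d = x.proj) :
    (g.act x).edgeAt d (h.trans (g.proj_act x).symm) =
      (g • (show (X.cover x₀).Edge from x.edgeAt d h) : (X.cover x₀).Edge) := by
  rcases d with ⟨e, _ | _⟩
  · exact Subtype.ext (Prod.ext (g.act_extend x _ _).symm rfl)
  · rfl

/-- Paths are lifted by extending on the right, which commutes with the action on the left. The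
start `y` is a separate variable because in the induction it becomes `(g.act x).extend [d]`, which
must first be identified with `g.act (x.extend [d])`. -/
theorem FundGroup.lift_act (g : X.FundGroup x₀) (x y : X.CoverVert x₀) (hy : y = g.act x)
    (l : List (X.Edge × Bool)) (h : IsEdgePath X.src X.tgt x.proj l)
    (h' : IsEdgePath X.src X.tgt y.proj l) :
    (y.lift l h').map Prod.fst = ((x.lift l h).map Prod.fst).map
      fun a : (X.cover x₀).Edge => (g • a : (X.cover x₀).Edge) := by
  induction l generalizing x y with
  | nil => rfl
  | cons d l ih =>
    subst hy
    simp only [CoverVert.lift, List.map_cons]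
    rw [ih (x.extend [d] ⟨h.1, trivial⟩) _ (g.act_extend x [d] ⟨h.1, trivial⟩).symm]
    exact congrArg (· :: _) (g.smul_edgeAt x d h.1)

theorem InBdry.smul {a : (X.cover x₀).Edge} {f : (X.cover x₀).Face}
    (h : (X.cover x₀).InBdry a f) (g : X.FundGroup x₀) :
    (X.cover x₀).InBdry (g • a) (g • f) := by
  have e : ((X.cover x₀).bdry (g • f)).map Prod.fst = (((X.cover x₀).bdry f).map Prod.fst).map
      fun a : (X.cover x₀).Edge => (g • a : (X.cover x₀).Edge) :=
    g.lift_act f.1.1 _ rfl _ _ _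
  rw [InBdry, e]
  exact List.mem_map_of_mem h

/-! ### Highest 1-cells -/

/-- A boundary path is a finite list, and a nonempty finite subset of a total order has a maximum.
-/
theorem exists_isHighest {Y : TwoComplex.{u}} {P : Set Y.Edge} {lt : Y.Edge → Y.Edge → Prop}
    (hlt : IsStrictTotalOrder P fun a b => lt a b) {f : Y.Face}
    (hf : ∃ e ∈ P, Y.InBdry e f) : ∃ e, Y.IsHighest P lt f e := by
  have hfin : {e : P | Y.InBdry e f}.Finite :=
    ((List.finite_toSet ((Y.bdry f).map Prod.fst)).preimage
      (Subtype.val_injective.injOn)).subset fun _ h => h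
  classical
  let _ := linearOrderOfSTO (fun a b : P => lt a b)
  obtain ⟨e₀, he₀, hb₀⟩ := hf
  obtain ⟨m, hm, hmax⟩ := hfin.exists_maximalFor id _ ⟨⟨e₀, he₀⟩, hb₀⟩
  refine ⟨m, ⟨m.2, hm⟩, fun e' he' hb' hne => ?_⟩
  have h1 : (⟨e', he'⟩ : P) ≤ m := by
    rcases le_total (⟨e', he'⟩ : P) m with h | h
    · exact h
    · exact hmax hb' h
  exact lt_of_le_of_ne h1 fun h => hne (congrArg Subtype.val h)

theorem IsHighest.unique {Y : TwoComplex.{u}} {P : Set Y.Edge} {lt : Y.Edge → Y.Edge → Prop}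
    (hlt : IsStrictTotalOrder P fun a b => lt a b) {f : Y.Face} {a b : Y.Edge}
    (ha : Y.IsHighest P lt f a) (hb : Y.IsHighest P lt f b) : a = b := by
  by_contra hne
  have h1 := ha.2 b hb.1.1 hb.1.2 (Ne.symm hne)
  have h2 := hb.2 a ha.1.1 ha.1.2 hne
  exact hlt.irrefl ⟨a, ha.1.1⟩ (hlt.trans ⟨a, ha.1.1⟩ ⟨b, hb.1.1⟩ ⟨a, ha.1.1⟩ h2 h1)

/-- A competitor in `∂(g • f)` is moved back to `∂f` by `g⁻¹`. Combined with uniqueness, this makes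
the choice of highest 1-cells equivariant. -/
theorem IsHighest.smul {P : Set (X.cover x₀).Edge}
    {lt : (X.cover x₀).Edge → (X.cover x₀).Edge → Prop}
    (hP : ∀ (g : X.FundGroup x₀), ∀ a ∈ P, g • a ∈ P)
    (hlt : ∀ (g : X.FundGroup x₀), ∀ a ∈ P, ∀ b ∈ P, lt a b → lt (g • a) (g • b))
    {f : (X.cover x₀).Face} {a : (X.cover x₀).Edge} (h : (X.cover x₀).IsHighest P lt f a)
    (g : X.FundGroup x₀) : (X.cover x₀).IsHighest P lt (g • f) (g • a) := by
  refine ⟨⟨hP g a h.1.1, h.1.2.smul g⟩, fun b hb hbf hne => ?_⟩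
  have h1 : (X.cover x₀).InBdry (g⁻¹ • b) f := by simpa using hbf.smul g⁻¹
  have h2 := h.2 (g⁻¹ • b) (hP _ _ hb) h1 fun h3 => hne (by rw [← h3, smul_inv_smul])
  simpa using hlt g _ (hP _ _ hb) _ h.1.1 h2

/-! ### From bislim structures to totally ordered ones -/

theorem BislimStructure.exists_isLinearOrder (hG : Szpilrajneous (X.FundGroup x₀))
    (B : X.BislimStructure x₀) :
    ∃ B' : X.BislimStructure x₀, IsLinearOrder (X.cover x₀).Edge B'.le := by
  have hrefl : ∀ (g : X.FundGroup x₀) a b, B.le (g • a) (g • b) → B.le a b := fun g a b h => by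
    simpa using B.le_smul g⁻¹ _ _ h
  obtain ⟨le', hlin, hinv, hext⟩ := hG (X.cover x₀).Edge edge_action_free
    -- The preorder may have distinct equivalent 1-cells; its strict part with equality added is
    -- antisymmetric, and the extension will break the ties.
    (fun a b => a = b ∨ (B.le a b ∧ ¬ B.le b a))
    { refl := fun a => Or.inl rfl
      trans := by
        rintro a b c (rfl | ⟨h1, h2⟩) (rfl | ⟨h3, h4⟩)
        · exact Or.inl rfl
        · exact Or.inr ⟨h3, h4⟩
        · exact Or.inr ⟨h1, h2⟩
        · exact Or.inr ⟨B.le_trans _ _ _ h1 h3, fun h => h2 (B.le_trans _ _ _ h3 h)⟩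
      antisymm := by
        rintro a b (rfl | ⟨h1, h2⟩) (h | ⟨h3, h4⟩)
        · rfl
        · rfl
        · exact h.symm
        · exact absurd h3 h2 }
    (by
      rintro g a b (rfl | ⟨h1, h2⟩)
      · exact Or.inl rfl
      · exact Or.inr ⟨B.le_smul g _ _ h1, fun h => h2 (hrefl g _ _ h)⟩)
  -- Strict inequalities survive: a reverse inequality in `le'` would force `a = b` by antisymmetry.
  have hstrict : ∀ a b, B.le a b ∧ ¬ B.le b a → le' a b ∧ ¬ le' b a := fun a b h =>
    ⟨hext _ _ (Or.inr h), fun h' => h.2 (by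
      rw [hlin.antisymm _ _ h' (hext _ _ (Or.inr h))]; exact B.le_refl _)⟩
  exact ⟨{ B with
    le := le'
    le_refl := hlin.refl
    le_trans := hlin.trans
    le_smul := hinv
    top_lt_of_top_mem := fun r₁ r₂ hne h => hstrict _ _ (B.top_lt_of_top_mem r₁ r₂ hne h)
    top_lt_of_bot_mem := fun r₁ r₂ hne h => hstrict _ _ (B.top_lt_of_bot_mem r₁ r₂ hne h) }, hlin⟩

theorem BislimStructure.isTotallyOrdered_of_isLinearOrder (B : X.BislimStructure x₀)
    (h : IsLinearOrder (X.cover x₀).Edge B.le) : B.IsTotallyOrdered where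
  refl a := h.refl a.1
  trans a b c := h.trans a.1 b.1 c.1
  antisymm a b hab hba := Subtype.ext (h.antisymm a.1 b.1 hab hba)
  total a b := h.total a.1 b.1

/-! ### From totally ordered bislim structures to staggerings -/

namespace BislimStructure

variable (B : X.BislimStructure x₀)

/-- A 1-cell distinguished for two different 2-cells would lie strictly below itself. -/
theorem top_injective : Function.Injective B.top := by
  intro r₁ r₂ h
  by_contra hne
  have h1 := B.top_lt_of_top_mem r₁ r₂ hne (h ▸ B.top_mem r₂)
  rw [h] at h1
  exact h1.2 h1.1

/-- A common `r⁻` lies in both boundaries, so the second bislim condition gives `r₁⁺ ≺ r₂⁺` and `r₂⁺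
≺ r₁⁺`. -/
theorem bot_injective : Function.Injective B.bot := by
  intro r₁ r₂ h
  by_contra hne
  have h1 := B.top_lt_of_bot_mem r₁ r₂ hne (h ▸ B.bot_mem r₁)
  have h2 := B.top_lt_of_bot_mem r₂ r₁ (Ne.symm hne) (h.symm ▸ B.bot_mem r₂)
  exact h1.2 h2.1

/-- The strict order of the 2-cells by their distinguished 1-cells `r⁺`. -/
def faceLt (r₁ r₂ : (X.cover x₀).Face) : Prop :=
  B.le (B.top r₁) (B.top r₂) ∧ ¬ B.le (B.top r₂) (B.top r₁)

/-- The relation on 1-cells which is transported from `faceLt` along a labelling of some 1-cells by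
2-cells. -/
def edgeLt (φ : (X.cover x₀).Face → (X.cover x₀).Edge) (a b : (X.cover x₀).Edge) : Prop :=
  ∃ r₁ r₂, φ r₁ = a ∧ φ r₂ = b ∧ B.faceLt r₁ r₂

variable {B}

theorem faceLt_smul (g : X.FundGroup x₀) {r₁ r₂ : (X.cover x₀).Face} (h : B.faceLt r₁ r₂) :
    B.faceLt (g • r₁) (g • r₂) := by
  unfold faceLt
  rw [B.top_smul, B.top_smul]
  exact ⟨B.le_smul g _ _ h.1, fun h' => h.2 (by simpa using B.le_smul g⁻¹ _ _ h')⟩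

/-- Incomparable 2-cells have the same `r⁺` by totality and antisymmetry on the range of `top`,
hence coincide by `top_injective`. -/
theorem isStrictTotalOrder_faceLt (hB : B.IsTotallyOrdered) :
    IsStrictTotalOrder (X.cover x₀).Face B.faceLt where
  irrefl r h := h.2 h.1
  trans r₁ r₂ r₃ h1 h2 :=
    ⟨B.le_trans _ _ _ h1.1 h2.1, fun h => h1.2 (B.le_trans _ _ _ h2.1 h)⟩
  trichotomous r₁ r₂ h1 h2 := by
    apply B.top_injective
    have hanti : B.le (B.top r₁) (B.top r₂) → B.le (B.top r₂) (B.top r₁) →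
        B.top r₁ = B.top r₂ := fun h h' =>
      congrArg Subtype.val (hB.antisymm ⟨_, r₁, rfl⟩ ⟨_, r₂, rfl⟩ h h')
    rcases hB.total ⟨_, r₁, rfl⟩ ⟨_, r₂, rfl⟩ with h | h
    · exact hanti h (by_contra fun h' => h1 ⟨h, h'⟩)
    · exact hanti (by_contra fun h' => h2 ⟨h, h'⟩) h

theorem edgeLt_apply {φ : (X.cover x₀).Face → (X.cover x₀).Edge} (hφ : Function.Injective φ)
    {r₁ r₂ : (X.cover x₀).Face} : B.edgeLt φ (φ r₁) (φ r₂) ↔ B.faceLt r₁ r₂ := by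
  constructor
  · rintro ⟨s₁, s₂, h1, h2, h⟩
    rwa [← hφ h1, ← hφ h2]
  · exact fun h => ⟨r₁, r₂, rfl, rfl, h⟩

theorem isStrictTotalOrder_edgeLt (hB : B.IsTotallyOrdered)
    {φ : (X.cover x₀).Face → (X.cover x₀).Edge} (hφ : Function.Injective φ) :
    IsStrictTotalOrder (Set.range φ) fun a b => B.edgeLt φ a b := by
  have hs := isStrictTotalOrder_faceLt hB
  refine { trichotomous := ?_, irrefl := ?_, trans := ?_ }
  · rintro ⟨_, r₁, rfl⟩ ⟨_, r₂, rfl⟩ h1 h2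
    refine Subtype.ext (congrArg φ (hs.trichotomous r₁ r₂ ?_ ?_))
    · exact fun h => h1 ((edgeLt_apply hφ).2 h)
    · exact fun h => h2 ((edgeLt_apply hφ).2 h)
  · rintro ⟨_, r, rfl⟩ h
    exact hs.irrefl r ((edgeLt_apply hφ).1 h)
  · rintro ⟨_, r₁, rfl⟩ ⟨_, r₂, rfl⟩ ⟨_, r₃, rfl⟩ h1 h2
    exact (edgeLt_apply hφ).2
      (hs.trans _ _ _ ((edgeLt_apply hφ).1 h1) ((edgeLt_apply hφ).1 h2))

theorem range_smul {φ : (X.cover x₀).Face → (X.cover x₀).Edge}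
    (hφ : ∀ (g : X.FundGroup x₀) r, φ (g • r) = g • φ r) (g : X.FundGroup x₀) :
    ∀ a ∈ Set.range φ, g • a ∈ Set.range φ := by
  rintro _ ⟨r, rfl⟩
  exact ⟨g • r, hφ g r⟩

theorem edgeLt_smul {φ : (X.cover x₀).Face → (X.cover x₀).Edge}
    (hφ : ∀ (g : X.FundGroup x₀) r, φ (g • r) = g • φ r) (g : X.FundGroup x₀)
    {a b : (X.cover x₀).Edge} : B.edgeLt φ a b → B.edgeLt φ (g • a) (g • b) := by
  rintro ⟨r₁, r₂, rfl, rfl, h⟩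
  exact ⟨g • r₁, g • r₂, hφ g r₁, hφ g r₂, faceLt_smul g h⟩

/-- This is the first bislim condition: any other `s⁺` in `∂r` satisfies `s⁺ ≺ r⁺`. -/
theorem isHighest_top (r : (X.cover x₀).Face) :
    (X.cover x₀).IsHighest (Set.range B.top) (B.edgeLt B.top) r (B.top r) := by
  refine ⟨⟨⟨r, rfl⟩, B.top_mem r⟩, ?_⟩
  rintro _ ⟨s, rfl⟩ hs hne
  exact ⟨s, r, rfl, rfl, B.top_lt_of_top_mem s r (fun h => hne (congrArg B.top h)) hs⟩

/-- This is the second bislim condition: any other `s⁻` in `∂r` forces `r⁺ ≺ s⁺`, which is how `r⁻`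
and `s⁻` are compared. -/
theorem isLowest_bot (r : (X.cover x₀).Face) :
    (X.cover x₀).IsHighest (Set.range B.bot) (fun a b => B.edgeLt B.bot b a) r (B.bot r) := by
  refine ⟨⟨⟨r, rfl⟩, B.bot_mem r⟩, ?_⟩
  rintro _ ⟨s, rfl⟩ hs hne
  exact ⟨r, s, rfl, rfl, B.top_lt_of_bot_mem r s (fun h => hne (congrArg B.bot h.symm)) hs⟩

theorem eq_top_of_isHighest (hB : B.IsTotallyOrdered) {r : (X.cover x₀).Face}
    {a : (X.cover x₀).Edge}
    (h : (X.cover x₀).IsHighest (Set.range B.top) (B.edgeLt B.top) r a) : a = B.top r :=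
  h.unique (isStrictTotalOrder_edgeLt hB B.top_injective) (isHighest_top r)

theorem eq_bot_of_isLowest (hB : B.IsTotallyOrdered) {r : (X.cover x₀).Face}
    {a : (X.cover x₀).Edge}
    (h : (X.cover x₀).IsHighest (Set.range B.bot) (fun a b => B.edgeLt B.bot b a) r a) :
    a = B.bot r :=
  haveI := isStrictTotalOrder_edgeLt hB B.bot_injective
  h.unique (inferInstanceAs (IsStrictTotalOrder _
    (Function.swap fun a b : Set.range B.bot => B.edgeLt B.bot a b)))
    (isLowest_bot r)

/-- All three orders are copies of the order on 2-cells, so the monotonicity of max and min is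
automatic once these are known to be `top` and `bot`. -/
theorem hasTIS (hB : B.IsTotallyOrdered) : X.HasTIS x₀ :=
  ⟨{ lt := B.faceLt
     lt_total := isStrictTotalOrder_faceLt hB
     lt_smul := fun g _ _ => faceLt_smul g
     plus := Set.range B.top
     plus_smul := range_smul B.top_smul
     ltPlus := B.edgeLt B.top
     ltPlus_total := isStrictTotalOrder_edgeLt hB B.top_injective
     ltPlus_smul := fun g _ _ _ _ => edgeLt_smul B.top_smul g
     minus := Set.range B.bot
     minus_smul := range_smul B.bot_smul
     ltMinus := B.edgeLt B.bot
     ltMinus_total := isStrictTotalOrder_edgeLt hB B.bot_injective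
     ltMinus_smul := fun g _ _ _ _ => edgeLt_smul B.bot_smul g
     exists_plus := fun r => ⟨B.top r, ⟨r, rfl⟩, B.top_mem r⟩
     exists_minus := fun r => ⟨B.bot r, ⟨r, rfl⟩, B.bot_mem r⟩
     max_once := fun r a h => by rw [eq_top_of_isHighest hB h]; exact B.top_once r
     max_lt_max := fun r₁ r₂ h a b ha hb =>
       ⟨r₁, r₂, (eq_top_of_isHighest hB ha).symm, (eq_top_of_isHighest hB hb).symm, h⟩
     min_lt_min := fun r₁ r₂ h a b ha hb =>
       ⟨r₁, r₂, (eq_bot_of_isLowest hB ha).symm, (eq_bot_of_isLowest hB hb).symm, h⟩ }⟩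

end BislimStructure

/-! ### From staggerings to bislim structures -/

theorem InvariantStaggering.isBislim (T : X.InvariantStaggering x₀) : X.IsBislim x₀ := by
  have hp := T.ltPlus_total
  -- Reversing the order turns lowest into highest, so the lemmas on highest 1-cells also give the
  -- minima.
  have hm : IsStrictTotalOrder T.minus fun a b => T.ltMinus b a :=
    haveI := T.ltMinus_total
    inferInstanceAs (IsStrictTotalOrder _ (Function.swap fun a b : T.minus => T.ltMinus a b))
  choose top htop using fun r => exists_isHighest hp (T.exists_plus r)
  choose bot hbot using fun r =>
    exists_isHighest (lt := fun a b => T.ltMinus b a) hm (T.exists_minus r)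
  have ptrans : ∀ a b c, a ∈ T.plus → b ∈ T.plus → c ∈ T.plus → T.ltPlus a b → T.ltPlus b c →
      T.ltPlus a c := fun a b c ha hb hc => hp.trans ⟨a, ha⟩ ⟨b, hb⟩ ⟨c, hc⟩
  have pirrefl : ∀ a ∈ T.plus, ¬ T.ltPlus a a := fun a ha => hp.irrefl ⟨a, ha⟩
  have mtrans : ∀ a b c, a ∈ T.minus → b ∈ T.minus → c ∈ T.minus → T.ltMinus b a →
      T.ltMinus c b → T.ltMinus c a := fun a b c ha hb hc => hm.trans ⟨a, ha⟩ ⟨b, hb⟩ ⟨c, hc⟩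
  have mirrefl : ∀ a ∈ T.minus, ¬ T.ltMinus a a := fun a ha => hm.irrefl ⟨a, ha⟩
  have hptop := fun r => (htop r).1.1
  have hmbot := fun r => (hbot r).1.1
  have htri : ∀ r₁ r₂, r₁ ≠ r₂ → T.lt r₁ r₂ ∨ T.lt r₂ r₁ := fun r₁ r₂ hne => by
    by_contra! h
    exact hne (T.lt_total.trichotomous r₁ r₂ h.1 h.2)
  have hmax : ∀ r₁ r₂, T.lt r₁ r₂ → T.ltPlus (top r₁) (top r₂) := fun r₁ r₂ h =>
    T.max_lt_max r₁ r₂ h _ _ (htop r₁) (htop r₂)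
  have hmin : ∀ r₁ r₂, T.lt r₁ r₂ → T.ltMinus (bot r₁) (bot r₂) := fun r₁ r₂ h =>
    T.min_lt_min r₁ r₂ h _ _ (hbot r₁) (hbot r₂)
  have hstrict : ∀ r₁ r₂, T.ltPlus (top r₁) (top r₂) →
      (top r₁ = top r₂ ∨
        (top r₁ ∈ T.plus ∧ top r₂ ∈ T.plus ∧ T.ltPlus (top r₁) (top r₂))) ∧
      ¬ (top r₂ = top r₁ ∨
        (top r₂ ∈ T.plus ∧ top r₁ ∈ T.plus ∧ T.ltPlus (top r₂) (top r₁))) := by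
    intro r₁ r₂ h
    refine ⟨Or.inr ⟨hptop _, hptop _, h⟩, ?_⟩
    rintro (h' | ⟨-, -, h'⟩)
    · rw [h'] at h
      exact pirrefl _ (hptop _) h
    · exact pirrefl _ (hptop _) (ptrans _ _ _ (hptop _) (hptop _) (hptop _) h h')
  exact ⟨{
    -- Outside `plus` the relation `ltPlus` carries no information, so those 1-cells are comparable
    -- only to themselves.
    le := fun a b => a = b ∨ (a ∈ T.plus ∧ b ∈ T.plus ∧ T.ltPlus a b)
    le_refl := fun a => Or.inl rfl
    le_trans := by
      rintro a b c (rfl | ⟨h1, h2, h3⟩) (rfl | ⟨h4, h5, h6⟩)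
      · exact Or.inl rfl
      · exact Or.inr ⟨h4, h5, h6⟩
      · exact Or.inr ⟨h1, h2, h3⟩
      · exact Or.inr ⟨h1, h5, ptrans _ _ _ h1 h2 h5 h3 h6⟩
    le_smul := by
      rintro g a b (rfl | ⟨h1, h2, h3⟩)
      · exact Or.inl rfl
      · exact Or.inr ⟨T.plus_smul g _ h1, T.plus_smul g _ h2, T.ltPlus_smul g _ h1 _ h2 h3⟩
    top := top
    bot := bot
    top_mem := fun r => (htop r).1.2
    bot_mem := fun r => (hbot r).1.2
    top_once := fun r => T.max_once r _ (htop r)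
    top_smul := fun g r =>
      (htop (g • r)).unique hp ((htop r).smul T.plus_smul T.ltPlus_smul g)
    bot_smul := fun g r =>
      (hbot (g • r)).unique (lt := fun a b => T.ltMinus b a) hm
        ((hbot r).smul T.minus_smul (fun g a ha b hb => T.ltMinus_smul g b hb a ha) g)
    top_lt_of_top_mem := fun r₁ r₂ hne h => by
      apply hstrict
      rcases htri r₁ r₂ hne with hlt | hlt
      · exact hmax _ _ hlt
      -- This case is contradictory, but the goal is immediate from the maximality of `top r₂` in
      -- `∂r₂`; monotonicity of the maxima only has to exclude `top r₁ = top r₂`.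
      · refine (htop r₂).2 _ (hptop r₁) h fun heq => ?_
        have h1 := hmax _ _ hlt
        rw [heq] at h1
        exact pirrefl _ (hptop _) h1
    top_lt_of_bot_mem := fun r₁ r₂ hne h => by
      apply hstrict
      rcases htri r₁ r₂ hne with hlt | hlt
      · exact hmax _ _ hlt
      -- As `bot r₂` lies in `∂r₁`, it cannot be below the minimum `bot r₁`, whereas `r₂ ≺ r₁` puts
      -- it there.
      · exfalso
        have h1 := hmin _ _ hlt
        by_cases heq : bot r₂ = bot r₁
        · rw [heq] at h1
          exact mirrefl _ (hmbot _) h1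
        · exact mirrefl _ (hmbot _) (mtrans _ _ _ (hmbot _) (hmbot _) (hmbot _)
            ((hbot r₁).2 _ (hmbot r₂) h heq) h1) }⟩

end TwoComplex

theorem mainTheorem10 {G S R : Type u} [Group G] (hG : Szpilrajneous G)
    (rel : R → List (S × Bool)) (e : GroupOfPresentation rel ≃* G)
    (himm : (presentationComplex rel).Immersed) :
    ((presentationComplex rel).IsBislim (presentationVertex rel) →
      (presentationComplex rel).IsTotallyOrderedBislim (presentationVertex rel)) ∧
    ((presentationComplex rel).IsBislim (presentationVertex rel) ↔
      (presentationComplex rel).HasTIS (presentationVertex rel)) := by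
  have hπ : Szpilrajneous
      ((presentationComplex rel).FundGroup (presentationVertex rel)) :=
    hG.of_mulEquiv ((MulEquiv.ofBijective _ (fundGroupHom_bijective rel)).trans e)
  have htbs : (presentationComplex rel).IsBislim (presentationVertex rel) →
      (presentationComplex rel).IsTotallyOrderedBislim (presentationVertex rel) := by
    rintro ⟨B⟩
    obtain ⟨B', hB'⟩ := B.exists_isLinearOrder hπ
    exact ⟨B', B'.isTotallyOrdered_of_isLinearOrder hB'⟩
  refine ⟨htbs, fun h => ?_, fun ⟨T⟩ => T.isBislim⟩
  obtain ⟨B, hB⟩ := htbs h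
  exact TwoComplex.BislimStructure.hasTIS hB
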